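/- Let $A, Z \in \mathbb{R}^{m\times n}$, let $r = \operatorname{rank}(A)$, and let $B = A + Z$. For a matrix $M \in \mathbb{R}^{m\times n}$ write $\sigma_1(M) \ge \sigma_2(M) \ge \dots \ge \sigma_{m\wedge n}(M) \ge 0$ for its singular values, where $m \wedge n = \min\{m,n\}$. For $1 \le q < \infty$ let $$\|M\|_q = \Big(\sum_{i=1}^{m\wedge n} \sigma_i(M)^q\Big)^{1/q}$$ be the Schatten-$q$ norm, and let $\|M\|_\infty = \|M\| = \sigma_1(M)$ be the spectral norm. If $M = \sum_{i=1}^{m\wedge n} \sigma_i(M)\, u_i v_i^\top$ is a singular value decomposition of $M$ (with orthonormal $u_i \in \mathbb{R}^m$ and orthonormal $v_i \in \mathbb{R}^n$), then $M_{\max(r)} = \sum_{i=1}^{r} \sigma_i(M)\, u_i v_i^\top$ is called a rank-$r$ truncated singular value decomposition (best rank-$r$ approximation) of $M$. Let $\widehat A = B_{\max(r)}$ and $Z_{\max(r)}$ be rank-$r$ truncated singular value decompositions of $B$ and of $Z$, respectively, for arbitrary choices of the singular vectors. Then $$\|\widehat A - A\|_q \le \begin{cases} (2^q+1)^{1/q}\,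 \|Z_{\max(r)}\|_q, & 1 \le q \le 2,\\ \sqrt5\, \|Z_{\max(r)}\|_q, & 2 \le q < \infty,\\ 2\, \|Z_{\max(r)}\|, & q = \infty. \end{cases}$$ -/

import Mathlib

open scoped ENNReal

noncomputable section

/-- The `i`-th singular value of a real matrix, in decreasing order and counted with multiplicity.
The index starts at `0`, so `singularValue M 0` is the largest one. -/
def singularValue {m n : ℕ} (M : Matrix (Fin m) (Fin n) ℝ) (i : ℕ) : ℝ :=
  (Matrix.toEuclideanLin M).singularValues i

/-- The Schatten-`q` norm of a real `m × n` matrix, meant for `1 ≤ q ≤ ∞`: the `ℓ^q` norm of its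
`min m n` singular values. For `q = ∞` it is the largest singular value (the spectral norm). -/
def schattenNorm {m n : ℕ} (q : ℝ≥0∞) (M : Matrix (Fin m) (Fin n) ℝ) : ℝ :=
  if q = ∞ then singularValue M 0
  else (∑ i : Fin (min m n), singularValue M i ^ q.toReal) ^ (1 / q.toReal)

/-- The families `u` and `v` are left and right singular vectors in a singular value decomposition
`M = ∑ i, σ i • u i (v i)ᵀ`. -/
def IsSVD {m n : ℕ} (M : Matrix (Fin m) (Fin n) ℝ)
    (u : Fin (min m n) → EuclideanSpace ℝ (Fin m))
    (v : Fin (min m n) → EuclideanSpace ℝ (Fin n)) : Prop :=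
  Orthonormal ℝ u ∧ Orthonormal ℝ v ∧
    M = ∑ i : Fin (min m n), singularValue M i • Matrix.vecMulVec (u i) (v i)

/-- `N` is a rank-`r` truncated singular value decomposition of `M`: the sum of the first `r` terms
of some singular value decomposition of `M`. (If the `r`-th and the `(r+1)`-st singular values
coincide, then `N` may depend on the choice of the singular vectors.) -/
def IsTruncatedSVD {m n : ℕ} (r : ℕ) (M N : Matrix (Fin m) (Fin n) ℝ) : Prop :=
  ∃ (u : Fin (min m n) → EuclideanSpace ℝ (Fin m)) (v : Fin (min m n) → EuclideanSpace ℝ (Fin n)),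
    IsSVD M u v ∧
    N = ∑ i : Fin (min m n) with i.val < r, singularValue M i • Matrix.vecMulVec (u i) (v i)

end

/-! Let `P` project onto the span `K` of the first `r` left singular vectors of `B`, so `Â = PB`.
Then `P(Â - A) = PZ`, while `P⊥(Â - A) = -P⊥A = P⊥Z - (B - Â)`. Both pieces have rank at most `r`.
By Weyl's inequality, as `rank A ≤ r`, the coefficients of `B - Â` are dominated by the singular
values of `Z`: `σ_{r+i}(B) ≤ σ_i(Z)`. So the first piece has Schatten norm at most `‖Z_max(r)‖_q`,
and the second at most twice that.

The pieces recombine by `‖T‖_q^q ≤ ‖PT‖_q^q + ‖P⊥T‖_q^q` for `q ≤ 2`, giving `1 + 2^q`, and by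
`‖T‖_q^2 ≤ ‖PT‖_q^2 + ‖P⊥T‖_q^2` for `q ≥ 2`, giving `1 + 4`. For `q = ∞` the triangle inequality
for `Â - A = Z - (B - Â)` suffices.

Norms are compared through diagonals: `∑ |⟪x i, T (y i)⟫| ^ q` over `l` pairs is at most the sum of
the `l` largest `σ^q`, with equality at singular pairs. Minkowski on such diagonals replaces the
triangle inequality for Schatten norms. -/

/-! ### Jensen and rearrangement inequalities -/

section RealInequalities

theorem Real.sq_rpow_half {t : ℝ} (ht : 0 ≤ t) {q : ℝ} : (t ^ 2) ^ (q / 2) = t ^ q := by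
  rw [← Real.rpow_natCast, ← Real.rpow_mul ht]
  congr 1
  push_cast
  ring

theorem Real.rpow_sum_mul_le_of_sum_le_one {ι : Type*} (s : Finset ι) (w z : ι → ℝ)
    (hw : ∀ i ∈ s, 0 ≤ w i) (hw1 : ∑ i ∈ s, w i ≤ 1) (hz : ∀ i ∈ s, 0 ≤ z i) {p : ℝ}
    (hp : 1 ≤ p) : (∑ i ∈ s, w i * z i) ^ p ≤ ∑ i ∈ s, w i * z i ^ p := by
  -- The missing mass `1 - ∑ w` is placed at the value `0`, which contributes nothing to either
  -- side.
  have h := Real.rpow_arith_mean_le_arith_mean_rpow s.insertNone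
    (fun o => o.elim (1 - ∑ i ∈ s, w i) w) (fun o => o.elim 0 z) (p := p) ?_ ?_ ?_ hp
  · have hp0 : p ≠ 0 := by linarith
    simpa [Finset.sum_insertNone, Real.zero_rpow hp0] using h
  · rintro (_ | i) hi
    · simpa using hw1
    · exact hw i (by simpa using hi)
  · simp [Finset.sum_insertNone]
  · rintro (_ | i) hi
    · simp
    · exact hz i (by simpa using hi)

theorem Real.sum_mul_rpow_le_of_sum_le_one {ι : Type*} (s : Finset ι) (w z : ι → ℝ)
    (hw : ∀ i ∈ s, 0 ≤ w i) (hw1 : ∑ i ∈ s, w i ≤ 1) (hz : ∀ i ∈ s, 0 ≤ z i) {p : ℝ}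
    (hp : 0 < p) (hp1 : p ≤ 1) : ∑ i ∈ s, w i * z i ^ p ≤ (∑ i ∈ s, w i * z i) ^ p := by
  have h := Real.rpow_sum_mul_le_of_sum_le_one s w (fun i => z i ^ p) hw hw1
    (fun i hi => Real.rpow_nonneg (hz i hi) p) (p := p⁻¹) ((one_le_inv₀ hp).2 hp1)
  have e : ∑ i ∈ s, w i * (z i ^ p) ^ p⁻¹ = ∑ i ∈ s, w i * z i :=
    Finset.sum_congr rfl fun i hi => by rw [Real.rpow_rpow_inv (hz i hi) hp.ne']
  rw [e] at h
  have h0 : 0 ≤ ∑ i ∈ s, w i * z i ^ p :=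
    Finset.sum_nonneg fun i hi => mul_nonneg (hw i hi) (Real.rpow_nonneg (hz i hi) p)
  have := Real.rpow_le_rpow (Real.rpow_nonneg h0 _) h hp.le
  rwa [Real.rpow_inv_rpow h0 hp.ne'] at this

theorem Finset.sum_mul_le_sum_range_of_antitone {ι : Type*} [Fintype ι] (c : ι → ℝ) (e : ι → ℕ)
    (he : Function.Injective e) (f : ℕ → ℝ) (hf : Antitone f) (hf0 : ∀ n, 0 ≤ f n) (l : ℕ)
    (hc0 : ∀ j, 0 ≤ c j) (hc1 : ∀ j, c j ≤ 1) (hc : ∑ j, c j ≤ l) :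
    ∑ j, c j * f (e j) ≤ ∑ n ∈ Finset.range l, f n := by
  classical
  -- Splitting at the threshold `f l`: only indices below `l` exceed it, and there `c j ≤ 1` bounds
  -- the excess.
  have h1 : ∀ j, c j * f (e j) ≤ c j * f l + (if e j < l then f (e j) - f l else 0) := by
    intro j
    split_ifs with h
    · nlinarith [hf h.le, hc1 j]
    · nlinarith [hf (not_lt.1 h), hc0 j]
  have h2 : ∑ j, (if e j < l then f (e j) - f l else 0) ≤ ∑ n ∈ Finset.range l, (f n - f l) := by
    rw [← Finset.sum_filter]
    rw [← Finset.sum_image (s := Finset.univ.filter fun j => e j < l) (g := e)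
      (f := fun n => f n - f l) he.injOn]
    refine Finset.sum_le_sum_of_subset_of_nonneg ?_ fun n hn _ => ?_
    · intro n
      simp only [Finset.mem_image, Finset.mem_filter, Finset.mem_univ, true_and, Finset.mem_range]
      rintro ⟨j, hj, rfl⟩
      exact hj
    · exact sub_nonneg.2 (hf (Finset.mem_range.1 hn).le)
  calc ∑ j, c j * f (e j)
      ≤ ∑ j, (c j * f l + (if e j < l then f (e j) - f l else 0)) :=
        Finset.sum_le_sum fun j _ => h1 j
    _ ≤ (∑ j, c j) * f l + ∑ n ∈ Finset.range l, (f n - f l) := by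
        rw [Finset.sum_add_distrib, ← Finset.sum_mul]
        gcongr
    _ ≤ l * f l + ∑ n ∈ Finset.range l, (f n - f l) := by
        gcongr
        exact hf0 l
    _ = ∑ n ∈ Finset.range l, f n := by
        simp [Finset.sum_sub_distrib]

end RealInequalities

/-! ### Bessel families and singular decompositions -/

section SingularDecomp

open scoped RealInnerProductSpace

variable {E F : Type*} [NormedAddCommGroup E] [InnerProductSpace ℝ E]
  [NormedAddCommGroup F] [InnerProductSpace ℝ F]

/-- The Bessel inequality for a finite family of vectors. -/
def IsBessel {κ : Type*} [Fintype κ] (x : κ → E) : Prop :=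
  ∀ a : E, ∑ i, ⟪x i, a⟫ ^ 2 ≤ ‖a‖ ^ 2

theorem Orthonormal.isBessel {κ : Type*} [Fintype κ] {x : κ → E} (hx : Orthonormal ℝ x) :
    IsBessel x := fun a => by
  simpa using hx.sum_inner_products_le a (s := Finset.univ)

theorem IsBessel.norm_sq_le_one {κ : Type*} [Fintype κ] {x : κ → E} (hx : IsBessel x) (i : κ) :
    ‖x i‖ ^ 2 ≤ 1 := by
  have h1 : ⟪x i, x i⟫ ^ 2 ≤ ‖x i‖ ^ 2 :=
    (Finset.single_le_sum (f := fun j => ⟪x j, x i⟫ ^ 2) (fun j _ => sq_nonneg _)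
      (Finset.mem_univ i)).trans (hx (x i))
  rw [real_inner_self_eq_norm_sq] at h1
  nlinarith [sq_nonneg ‖x i‖]

/-- Projection destroys orthonormality but not the Bessel inequality; this is why diagonals are
tested on Bessel families. -/
theorem IsBessel.starProjection {κ : Type*} [Fintype κ] {x : κ → E} (hx : IsBessel x)
    (K : Submodule ℝ E) [K.HasOrthogonalProjection] :
    IsBessel fun i => K.starProjection (x i) := fun a => by
  simp_rw [Submodule.inner_starProjection_left_eq_right]
  refine (hx _).trans ?_
  gcongr
  exact K.norm_starProjection_apply_le a

theorem Orthonormal.norm_sq_sum_smul {κ : Type*} [Fintype κ] {x : κ → E} (hx : Orthonormal ℝ x)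
    (c : κ → ℝ) : ‖∑ i, c i • x i‖ ^ 2 = ∑ i, c i ^ 2 := by
  rw [← real_inner_self_eq_norm_sq, hx.inner_sum]
  simp [sq]

/-- `T = ∑ j, s j • u j ⊗ v j` with orthonormal families `u` and `v`. -/
structure SingularDecomp {ι : Type*} [Fintype ι] (T : E →ₗ[ℝ] F) (s : ι → ℝ) (u : ι → F)
    (v : ι → E) : Prop where
  left : Orthonormal ℝ u
  right : Orthonormal ℝ v
  apply_eq : ∀ x, T x = ∑ j, (s j * ⟪v j, x⟫) • u j

namespace SingularDecomp

variable {ι : Type*} [Fintype ι] {T : E →ₗ[ℝ] F} {s : ι → ℝ} {u : ι → F} {v : ι → E}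

theorem apply_right (h : SingularDecomp T s u v) (j : ι) : T (v j) = s j • u j := by
  classical
  rw [h.apply_eq, Finset.sum_eq_single j]
  · simp [h.right.1 j]
  · intro b _ hb
    simp [h.right.2 hb]
  · simp

theorem inner_left_apply (h : SingularDecomp T s u v) (j : ι) (x : E) :
    ⟪u j, T x⟫ = s j * ⟪v j, x⟫ := by
  rw [h.apply_eq, h.left.inner_right_sum _ (Finset.mem_univ j)]

theorem inner_left_apply_right (h : SingularDecomp T s u v) (j : ι) : ⟪u j, T (v j)⟫ = s j := by
  simp [h.inner_left_apply, h.right.1 j]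

theorem norm_sq_apply (h : SingularDecomp T s u v) (x : E) :
    ‖T x‖ ^ 2 = ∑ j, s j ^ 2 * ⟪v j, x⟫ ^ 2 := by
  rw [h.apply_eq, h.left.norm_sq_sum_smul]
  simp [mul_pow]

/-- The diagonal of `T` with respect to two Bessel families is weakly majorized by the
coefficients of a singular decomposition. -/
theorem sum_rpow_abs_inner_le (h : SingularDecomp T s u v) (hs : ∀ j, 0 ≤ s j) (e : ι → ℕ)
    (he : Function.Injective e) (f : ℕ → ℝ) (hf : Antitone f) (hf0 : ∀ n, 0 ≤ f n)
    (hsf : ∀ j, s j ≤ f (e j)) {l : ℕ} {x : Fin l → F} {y : Fin l → E} (hx : IsBessel x)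
    (hy : IsBessel y) {q : ℝ} (hq : 1 ≤ q) :
    ∑ i, |⟪x i, T (y i)⟫| ^ q ≤ ∑ n ∈ Finset.range l, f n ^ q := by
  have hq0 : 0 ≤ q := by linarith
  -- AM-GM bounds `|⟪x i, u j⟫ * ⟪v j, y i⟫|` by `w i j`, and Bessel makes `w` doubly substochastic.
  -- Jensen uses the row sums, rearrangement the column sums and the total mass at most `l`.
  set w : Fin l → ι → ℝ := fun i j => (⟪x i, u j⟫ ^ 2 + ⟪v j, y i⟫ ^ 2) / 2 with hw
  have hw0 : ∀ i j, 0 ≤ w i j := fun i j => by positivity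
  have hrow : ∀ i, ∑ j, w i j ≤ 1 := by
    intro i
    have h1 : ∑ j, ⟪x i, u j⟫ ^ 2 ≤ 1 := by
      simp_rw [real_inner_comm _ (x i)]
      exact (h.left.isBessel _).trans (hx.norm_sq_le_one i)
    have h2 : ∑ j, ⟪v j, y i⟫ ^ 2 ≤ 1 := (h.right.isBessel _).trans (hy.norm_sq_le_one i)
    rw [hw, ← Finset.sum_div, Finset.sum_add_distrib]
    linarith
  have hcol : ∀ j, ∑ i, w i j ≤ 1 := by
    intro j
    have h1 : ∑ i, ⟪x i, u j⟫ ^ 2 ≤ 1 := (hx _).trans (by simp [h.left.1 j])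
    have h2 : ∑ i, ⟪v j, y i⟫ ^ 2 ≤ 1 := by
      simp_rw [real_inner_comm _ (v j)]
      exact (hy _).trans (by simp [h.right.1 j])
    rw [hw, ← Finset.sum_div, Finset.sum_add_distrib]
    linarith
  have hterm : ∀ i, |⟪x i, T (y i)⟫| ≤ ∑ j, w i j * s j := by
    intro i
    rw [h.apply_eq, inner_sum]
    refine (Finset.abs_sum_le_sum_abs _ _).trans (Finset.sum_le_sum fun j _ => ?_)
    rw [real_inner_smul_right, mul_assoc, abs_mul, abs_of_nonneg (hs j), mul_comm]
    refine mul_le_mul_of_nonneg_right ?_ (hs j)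
    rw [hw, abs_le]
    constructor
    · linarith [sq_nonneg (⟪x i, u j⟫ + ⟪v j, y i⟫)]
    · linarith [sq_nonneg (⟪x i, u j⟫ - ⟪v j, y i⟫)]
  calc ∑ i, |⟪x i, T (y i)⟫| ^ q
      ≤ ∑ i, ∑ j, w i j * s j ^ q := by
        refine Finset.sum_le_sum fun i _ => ?_
        exact (Real.rpow_le_rpow (abs_nonneg _) (hterm i) hq0).trans
          (Real.rpow_sum_mul_le_of_sum_le_one _ _ _ (fun j _ => hw0 i j) (hrow i)
            (fun j _ => hs j) hq)
    _ = ∑ j, (∑ i, w i j) * s j ^ q := by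
        rw [Finset.sum_comm]
        simp_rw [Finset.sum_mul]
    _ ≤ ∑ j, (∑ i, w i j) * f (e j) ^ q := by
        refine Finset.sum_le_sum fun j _ => ?_
        exact mul_le_mul_of_nonneg_left (Real.rpow_le_rpow (hs j) (hsf j) hq0)
          (Finset.sum_nonneg fun i _ => hw0 i j)
    _ ≤ ∑ n ∈ Finset.range l, f n ^ q := by
        refine Finset.sum_mul_le_sum_range_of_antitone _ e he (fun n => f n ^ q)
          (fun a b hab => Real.rpow_le_rpow (hf0 b) (hf hab) hq0)
          (fun n => Real.rpow_nonneg (hf0 n) q) l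
          (fun j => Finset.sum_nonneg fun i _ => hw0 i j) hcol ?_
        rw [Finset.sum_comm]
        exact (Finset.sum_le_sum fun i _ => hrow i).trans (by simp)

/-- The `q`-th powers of the norms of the columns of `T`, for `q ≥ 2`. -/
theorem sum_norm_rpow_le (h : SingularDecomp T s u v) (hs : ∀ j, 0 ≤ s j) {κ : Type*} [Fintype κ]
    {y : κ → E} (hy : IsBessel y) {q : ℝ} (hq : 2 ≤ q) :
    ∑ k, ‖T (y k)‖ ^ q ≤ ∑ j, s j ^ q := by
  calc ∑ k, ‖T (y k)‖ ^ q ≤ ∑ k, ∑ j, ⟪v j, y k⟫ ^ 2 * s j ^ q := by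
        refine Finset.sum_le_sum fun k _ => ?_
        -- Jensen for the convex function `t ^ (q / 2)`, with weights `⟪v j, y k⟫ ^ 2`.
        rw [← Real.sq_rpow_half (norm_nonneg _), h.norm_sq_apply]
        simp_rw [mul_comm (s _ ^ 2)]
        refine (Real.rpow_sum_mul_le_of_sum_le_one _ _ _ (fun j _ => sq_nonneg _)
          ((h.right.isBessel _).trans (hy.norm_sq_le_one k)) (fun j _ => sq_nonneg _)
          (by linarith)).trans_eq ?_
        exact Finset.sum_congr rfl fun j _ => by rw [Real.sq_rpow_half (hs j)]
    _ = ∑ j, (∑ k, ⟪y k, v j⟫ ^ 2) * s j ^ q := by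
        rw [Finset.sum_comm]
        simp_rw [Finset.sum_mul, real_inner_comm]
    _ ≤ ∑ j, s j ^ q := by
        refine Finset.sum_le_sum fun j _ => ?_
        refine mul_le_of_le_one_left (Real.rpow_nonneg (hs j) q) ((hy _).trans ?_)
        simp [h.right.1 j]

end SingularDecomp

end SingularDecomp

/-! ### Singular values: Weyl's inequality and splitting along a subspace -/

section SingularValues

open scoped RealInnerProductSpace
open Module

variable {E F : Type*} [NormedAddCommGroup E] [InnerProductSpace ℝ E] [FiniteDimensional ℝ E]
  [NormedAddCommGroup F] [InnerProductSpace ℝ F] [FiniteDimensional ℝ F]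

namespace LinearMap

theorem inner_map_eigenvectorBasis (T : E →ₗ[ℝ] F) (i j : Fin (finrank ℝ E)) :
    ⟪T (T.isSymmetric_adjoint_comp_self.eigenvectorBasis rfl i),
      T (T.isSymmetric_adjoint_comp_self.eigenvectorBasis rfl j)⟫ =
      if i = j then T.singularValues i ^ 2 else 0 := by
  have h := T.isSymmetric_adjoint_comp_self.apply_eigenvectorBasis rfl j
  rw [← T.sq_singularValues_fin rfl] at h
  rw [← adjoint_inner_right, ← comp_apply, h]
  simp only [RCLike.ofReal_real_eq_id, id_eq, real_inner_smul_right]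
  rw [orthonormal_iff_ite.1 (OrthonormalBasis.orthonormal _) i j]
  split_ifs with hij
  · simp [hij]
  · simp

/-- The `v j` are eigenvectors of `T* T` and `u j = T (v j) / σ_j`. Indexing by the rank keeps every
`σ_j` positive; `T` kills the remaining eigenvectors. -/
theorem exists_singularDecomp (T : E →ₗ[ℝ] F) :
    ∃ (u : Fin (finrank ℝ T.range) → F) (v : Fin (finrank ℝ T.range) → E),
      SingularDecomp T (fun j : Fin (finrank ℝ T.range) => T.singularValues j) u v := by
  set b := T.isSymmetric_adjoint_comp_self.eigenvectorBasis rfl with hb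
  have hk : finrank ℝ T.range ≤ finrank ℝ E := T.finrank_range_le
  have hpos : ∀ j : Fin (finrank ℝ T.range), 0 < T.singularValues j := fun j =>
    T.singularValues_pos_iff_lt_finrank_range.2 j.2
  have hu : ∀ i : Fin (finrank ℝ T.range),
      T (b (i.castLE hk)) =
        T.singularValues i • ((T.singularValues i)⁻¹ • T (b (i.castLE hk))) := fun i => by
    rw [smul_smul, mul_inv_cancel₀ (hpos i).ne', one_smul]
  refine ⟨fun j => (T.singularValues j)⁻¹ • T (b (j.castLE hk)), fun j => b (j.castLE hk),
    ?_, ?_, ?_⟩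
  · rw [orthonormal_iff_ite]
    intro i j
    rw [real_inner_smul_left, real_inner_smul_right, hb, inner_map_eigenvectorBasis]
    by_cases hij : i = j
    · subst hij
      have := (hpos i).ne'
      simp only [if_true, Fin.val_castLE]
      field_simp
    · simp [hij]
  · exact b.orthonormal.comp _ (Fin.castLE_injective hk)
  · intro x
    have hz : ∀ i : Fin (finrank ℝ E), finrank ℝ T.range ≤ i → T (b i) = 0 := by
      intro i hi
      have h0 := T.inner_map_eigenvectorBasis i i
      rw [T.singularValues_eq_zero_iff_le_finrank_range.2 hi] at h0
      simpa using h0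
    conv_lhs => rw [← b.sum_repr' x, map_sum]
    simp_rw [map_smul, mul_comm (T.singularValues _), mul_smul, ← hu]
    symm
    rw [← Finset.sum_image (s := Finset.univ) (g := Fin.castLE hk)
      (f := fun i => ⟪b i, x⟫ • T (b i)) (Fin.castLE_injective hk).injOn]
    refine Finset.sum_subset (Finset.subset_univ _) fun i _ hi => ?_
    rw [hz i, smul_zero]
    by_contra hlt
    exact hi (Finset.mem_image.2 ⟨⟨i, not_le.1 hlt⟩, Finset.mem_univ _, rfl⟩)

/-- The sum of the `q`-th powers of the nonzero singular values. -/
noncomputable def schattenSum (T : E →ₗ[ℝ] F) (q : ℝ) : ℝ :=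
  ∑ j : Fin (finrank ℝ T.range), T.singularValues j ^ q

theorem schattenSum_nonneg (T : E →ₗ[ℝ] F) (q : ℝ) : 0 ≤ T.schattenSum q :=
  Finset.sum_nonneg fun j _ => Real.rpow_nonneg (T.singularValues_nonneg j) q

theorem sum_range_singularValues_rpow_eq (T : E →ₗ[ℝ] F) {q : ℝ} (hq : q ≠ 0) {l : ℕ}
    (hl : finrank ℝ T.range ≤ l) :
    ∑ n ∈ Finset.range l, T.singularValues n ^ q = T.schattenSum q := by
  rw [schattenSum, Fin.sum_univ_eq_sum_range (fun n => T.singularValues n ^ q)]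
  symm
  refine Finset.sum_subset (Finset.range_mono hl) fun n _ hn => ?_
  rw [T.singularValues_eq_zero_iff_le_finrank_range.2 (by simpa using hn), Real.zero_rpow hq]

theorem sum_range_singularValues_rpow_mono (T : E →ₗ[ℝ] F) (q : ℝ) {k l : ℕ} (hkl : k ≤ l) :
    ∑ n ∈ Finset.range k, T.singularValues n ^ q ≤
      ∑ n ∈ Finset.range l, T.singularValues n ^ q :=
  Finset.sum_le_sum_of_subset_of_nonneg (Finset.range_mono hkl) fun n _ _ =>
    Real.rpow_nonneg (T.singularValues_nonneg n) q

theorem sum_range_singularValues_rpow_le (T : E →ₗ[ℝ] F) {q : ℝ} (hq : q ≠ 0) (l : ℕ) :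
    ∑ n ∈ Finset.range l, T.singularValues n ^ q ≤ T.schattenSum q := by
  rw [← T.sum_range_singularValues_rpow_eq hq (le_max_right l _)]
  exact T.sum_range_singularValues_rpow_mono q (le_max_left l _)

theorem sum_rpow_abs_inner_le (T : E →ₗ[ℝ] F) {l : ℕ} {x : Fin l → F} {y : Fin l → E}
    (hx : IsBessel x) (hy : IsBessel y) {q : ℝ} (hq : 1 ≤ q) :
    ∑ i, |⟪x i, T (y i)⟫| ^ q ≤ ∑ n ∈ Finset.range l, T.singularValues n ^ q := by
  obtain ⟨u, v, h⟩ := T.exists_singularDecomp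
  exact h.sum_rpow_abs_inner_le (fun j => T.singularValues_nonneg j) (fun j => j)
    Fin.val_injective T.singularValues T.singularValues_antitone T.singularValues_nonneg
    (fun j => le_rfl) hx hy hq

theorem abs_inner_le_singularValues_zero (T : E →ₗ[ℝ] F) {x : F} {y : E} (hx : ‖x‖ = 1)
    (hy : ‖y‖ = 1) : |⟪x, T y⟫| ≤ T.singularValues 0 := by
  have h := T.sum_rpow_abs_inner_le (l := 1) (x := fun _ => x) (y := fun _ => y)
    (Orthonormal.isBessel ⟨fun _ => hx, fun i j hij => (hij (Subsingleton.elim i j)).elim⟩)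
    (Orthonormal.isBessel ⟨fun _ => hy, fun i j hij => (hij (Subsingleton.elim i j)).elim⟩)
    (q := 1) le_rfl
  simpa using h

/-- Weyl's inequality for a perturbation of a map of rank at most `r`. -/
theorem singularValues_add_le (a z : E →ₗ[ℝ] F) {r : ℕ} (hr : finrank ℝ a.range ≤ r) (i : ℕ) :
    (a + z).singularValues (r + i) ≤ z.singularValues i := by
  by_contra! hlt
  obtain ⟨u, v, h⟩ := (a + z).exists_singularDecomp
  obtain ⟨u', v', h'⟩ := z.exists_singularDecomp
  have hk : r + i + 1 ≤ finrank ℝ (a + z).range :=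
    (a + z).singularValues_pos_iff_lt_finrank_range.1 ((z.singularValues_nonneg i).trans_lt hlt)
  set w : Fin (r + i + 1) → E := fun j => v (j.castLE hk) with hw
  have hwo : Orthonormal ℝ w := h.right.comp _ (Fin.castLE_injective hk)
  set φ : (Fin (r + i + 1) → ℝ) →ₗ[ℝ] E := Fintype.linearCombination ℝ w with hφ
  -- At most `r + i` linear conditions on a space of dimension `r + i + 1`: some nonzero `x` in the
  -- span of leading right singular vectors of `a + z` is killed by `a` and orthogonal to the first
  -- `i` of `z`. Past the rank of `z` no condition is needed, hence the `0`.
  set ψ : E →ₗ[ℝ] a.range × (Fin i → ℝ) := a.rangeRestrict.prod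
    (LinearMap.pi fun j => if hj : j.val < finrank ℝ z.range then
      (innerSL ℝ (v' ⟨j, hj⟩)).toLinearMap else 0) with hψ
  have hker : (ψ ∘ₗ φ).ker ≠ ⊥ := by
    apply LinearMap.ker_ne_bot_of_finrank_lt
    simp only [finrank_prod, finrank_fin_fun]
    omega
  obtain ⟨c, hc, hc0⟩ := Submodule.exists_mem_ne_zero_of_ne_bot hker
  set x := φ c with hx
  have hψx : ψ x = 0 := hc
  have hax : a x = 0 := congrArg (fun p => (p.1 : F)) hψx
  have hvx : ∀ j : Fin (finrank ℝ z.range), j.val < i → ⟪v' j, x⟫ = 0 := by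
    intro j hj
    have := congrFun (congrArg Prod.snd hψx) ⟨j, hj⟩
    simpa [hψ] using this
  have hxs : x = ∑ j, c j • w j := by simp [hx, hφ, Fintype.linearCombination_apply]
  have hxn : ‖x‖ ^ 2 = ∑ j, c j ^ 2 := by rw [hxs, hwo.norm_sq_sum_smul]
  have hxpos : 0 < ‖x‖ ^ 2 := by
    rw [hxn]
    obtain ⟨j, hj⟩ := Function.ne_iff.1 hc0
    exact Finset.sum_pos' (fun j _ => sq_nonneg _) ⟨j, Finset.mem_univ _, by
      have : c j ≠ 0 := hj
      positivity⟩
  have hlow : (a + z).singularValues (r + i) ^ 2 * ‖x‖ ^ 2 ≤ ‖(a + z) x‖ ^ 2 := by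
    have e : (a + z) x = ∑ j : Fin (r + i + 1),
        (c j * (a + z).singularValues j) • u (j.castLE hk) := by
      rw [hxs, map_sum]
      refine Finset.sum_congr rfl fun j _ => ?_
      rw [map_smul, hw, h.apply_right, smul_smul]
      rfl
    have huo : Orthonormal ℝ fun j : Fin (r + i + 1) => u (j.castLE hk) :=
      h.left.comp _ (Fin.castLE_injective hk)
    rw [e, huo.norm_sq_sum_smul, hxn, Finset.mul_sum]
    refine Finset.sum_le_sum fun j _ => ?_
    rw [mul_pow, mul_comm]
    have h1 : (a + z).singularValues (r + i) ≤ (a + z).singularValues j :=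
      (a + z).singularValues_antitone (by omega)
    have h2 := (a + z).singularValues_nonneg (r + i)
    gcongr
  have hup : ‖z x‖ ^ 2 ≤ z.singularValues i ^ 2 * ‖x‖ ^ 2 := by
    rw [h'.norm_sq_apply]
    refine le_trans (Finset.sum_le_sum (g := fun j => z.singularValues i ^ 2 * ⟪v' j, x⟫ ^ 2)
      fun j _ => ?_) ?_
    · by_cases hj : j.val < i
      · simp [hvx j hj]
      · have h1 : z.singularValues j ≤ z.singularValues i :=
          z.singularValues_antitone (not_lt.1 hj)
        have h2 := z.singularValues_nonneg j
        gcongr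
    · rw [← Finset.mul_sum]
      exact mul_le_mul_of_nonneg_left (h'.right.isBessel x) (sq_nonneg _)
  rw [add_apply, hax, zero_add] at hlow
  have h3 := le_of_mul_le_mul_right (hlow.trans hup) hxpos
  have h4 : z.singularValues i ^ 2 < (a + z).singularValues (r + i) ^ 2 :=
    pow_lt_pow_left₀ hlt (z.singularValues_nonneg i) two_ne_zero
  linarith

/-- Pinching inequality: compression of the left singular vectors of `T` to a subspace. -/
theorem _root_.SingularDecomp.sum_rpow_mul_norm_sq_starProjection_le {ι : Type*} [Fintype ι]
    {T : E →ₗ[ℝ] F} {s : ι → ℝ} {u : ι → F} {v : ι → E} (h : SingularDecomp T s u v)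
    (hs : ∀ j, 0 < s j) (K : Submodule ℝ F) {q : ℝ} (hq : 0 < q) (hq2 : q ≤ 2) :
    ∑ k, s k ^ q * ‖K.starProjection (u k)‖ ^ 2 ≤
      schattenSum (K.starProjection.toLinearMap ∘ₗ T) q := by
  set X := K.starProjection.toLinearMap ∘ₗ T with hX
  have hXa : ∀ w, X w = K.starProjection (T w) := fun w => rfl
  obtain ⟨x, y, hd⟩ := X.exists_singularDecomp
  have hpos : ∀ j : Fin (finrank ℝ X.range), 0 < X.singularValues j := fun j =>
    X.singularValues_pos_iff_lt_finrank_range.2 j.2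
  have hxK : ∀ i, x i ∈ K := fun i => by
    have e : x i = (X.singularValues i)⁻¹ • X (y i) := by
      rw [hd.apply_right, smul_smul, inv_mul_cancel₀ (hpos i).ne', one_smul]
    rw [e]
    exact K.smul_mem _ (K.starProjection_apply_mem _)
  -- Both sides are `⟪x i, T (v k)⟫`, because `x i` lies in `K`.
  have hinner : ∀ i k, s k * ⟪x i, u k⟫ = X.singularValues i * ⟪y i, v k⟫ := by
    intro i k
    rw [← real_inner_smul_right, ← h.apply_right, ← hd.inner_left_apply, hXa,
      ← Submodule.inner_starProjection_left_eq_right, K.starProjection_eq_self_iff.2 (hxK i)]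
  have hnorm : ∀ k, ‖K.starProjection (u k)‖ ^ 2 = ∑ i, ⟪x i, u k⟫ ^ 2 := by
    intro k
    have e : K.starProjection (u k) = ∑ i, ⟪x i, u k⟫ • x i := by
      have e1 : s k • K.starProjection (u k) = X (v k) := by
        rw [hXa, h.apply_right, map_smul]
      rw [← inv_smul_smul₀ (hs k).ne' (K.starProjection (u k)), e1, hd.apply_eq, Finset.smul_sum]
      refine Finset.sum_congr rfl fun i _ => ?_
      rw [← hinner, smul_smul, inv_mul_cancel_left₀ (hs k).ne']
    rw [e, hd.left.norm_sq_sum_smul]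
  -- Concave Jensen for `t ^ (q / 2)`: the same weights give `s k ^ 2` a sum of at most `σ_i(X) ^
  -- 2`.
  have hrow : ∀ i, ∑ k, ⟪x i, u k⟫ ^ 2 * s k ^ q ≤ X.singularValues i ^ q := by
    intro i
    have h1 : ∑ k, ⟪x i, u k⟫ ^ 2 ≤ 1 := by
      simp_rw [real_inner_comm _ (x i)]
      exact (h.left.isBessel _).trans (by simp [hd.left.1 i])
    have h2 : ∑ k, ⟪x i, u k⟫ ^ 2 * s k ^ 2 ≤ X.singularValues i ^ 2 := by
      have e : ∀ k, ⟪x i, u k⟫ ^ 2 * s k ^ 2 = X.singularValues i ^ 2 * ⟪v k, y i⟫ ^ 2 := by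
        intro k
        rw [← mul_pow, mul_comm, hinner, mul_pow, real_inner_comm]
      simp_rw [e, ← Finset.mul_sum]
      refine mul_le_of_le_one_right (sq_nonneg _) ((h.right.isBessel _).trans ?_)
      simp [hd.right.1 i]
    rw [← Real.sq_rpow_half (hpos i).le]
    simp_rw [← fun k => Real.sq_rpow_half (q := q) (hs k).le]
    refine (Real.sum_mul_rpow_le_of_sum_le_one _ _ _ (fun k _ => sq_nonneg _) h1
      (fun k _ => sq_nonneg _) (by linarith) (by linarith)).trans ?_
    exact Real.rpow_le_rpow (Finset.sum_nonneg fun k _ => by positivity) h2 (by linarith)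
  calc ∑ k, s k ^ q * ‖K.starProjection (u k)‖ ^ 2
      = ∑ i, ∑ k, ⟪x i, u k⟫ ^ 2 * s k ^ q := by
        rw [Finset.sum_comm]
        refine Finset.sum_congr rfl fun k _ => ?_
        rw [hnorm, mul_comm, Finset.sum_mul]
    _ ≤ schattenSum X q := Finset.sum_le_sum fun i _ => hrow i

/-- Each unit vector `u j` splits by Pythagoras, so `σ_j ^ q` is shared between `K` and `Kᗮ`;
pinching bounds each share. -/
theorem schattenSum_le_add_of_le_two (T : E →ₗ[ℝ] F) (K : Submodule ℝ F) {q : ℝ} (hq : 0 < q)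
    (hq2 : q ≤ 2) :
    T.schattenSum q ≤ schattenSum (K.starProjection.toLinearMap ∘ₗ T) q +
      schattenSum (Kᗮ.starProjection.toLinearMap ∘ₗ T) q := by
  obtain ⟨u, v, h⟩ := T.exists_singularDecomp
  have hpos : ∀ j : Fin (finrank ℝ T.range), 0 < T.singularValues j := fun j =>
    T.singularValues_pos_iff_lt_finrank_range.2 j.2
  refine le_trans (le_of_eq ?_) (add_le_add
    (h.sum_rpow_mul_norm_sq_starProjection_le hpos K hq hq2)
    (h.sum_rpow_mul_norm_sq_starProjection_le hpos Kᗮ hq hq2))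
  rw [← Finset.sum_add_distrib, schattenSum]
  refine Finset.sum_congr rfl fun j _ => ?_
  rw [← mul_add, ← Submodule.norm_sq_eq_add_norm_sq_starProjection, h.left.1 j]
  simp

/-- Pythagoras splits `σ_j ^ 2 = ‖T (v j)‖ ^ 2`; Minkowski in `ℓ^(q/2)` separates the parts, and
each column sum is bounded by `sum_norm_rpow_le`. -/
theorem schattenSum_rpow_le_add_of_two_le (T : E →ₗ[ℝ] F) (K : Submodule ℝ F) {q : ℝ}
    (hq : 2 ≤ q) :
    T.schattenSum q ^ (2 / q) ≤
      schattenSum (K.starProjection.toLinearMap ∘ₗ T) q ^ (2 / q) +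
      schattenSum (Kᗮ.starProjection.toLinearMap ∘ₗ T) q ^ (2 / q) := by
  obtain ⟨u, v, h⟩ := T.exists_singularDecomp
  have hcol : ∀ X : E →ₗ[ℝ] F, ∑ j, (‖X (v j)‖ ^ 2) ^ (q / 2) ≤ X.schattenSum q := by
    intro X
    obtain ⟨x, y, hX⟩ := X.exists_singularDecomp
    simp_rw [Real.sq_rpow_half (norm_nonneg _)]
    exact hX.sum_norm_rpow_le (fun j => X.singularValues_nonneg j) h.right.isBessel hq
  set X := K.starProjection.toLinearMap ∘ₗ T
  set Y := Kᗮ.starProjection.toLinearMap ∘ₗ T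
  have hM := Real.Lp_add_le_of_nonneg (s := Finset.univ) (p := q / 2)
    (f := fun j => ‖X (v j)‖ ^ 2) (g := fun j => ‖Y (v j)‖ ^ 2) (by linarith)
    (fun j _ => sq_nonneg _) (fun j _ => sq_nonneg _)
  have e : ∑ j, (‖X (v j)‖ ^ 2 + ‖Y (v j)‖ ^ 2) ^ (q / 2) = T.schattenSum q := by
    refine Finset.sum_congr rfl fun j _ => ?_
    have e1 : ‖X (v j)‖ ^ 2 + ‖Y (v j)‖ ^ 2 = ‖T (v j)‖ ^ 2 :=
      (Submodule.norm_sq_eq_add_norm_sq_starProjection (T (v j)) K).symm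
    rw [e1, Real.sq_rpow_half (norm_nonneg _), h.apply_right, norm_smul, h.left.1 j, mul_one,
      Real.norm_of_nonneg (T.singularValues_nonneg _)]
  rw [e, one_div_div] at hM
  have h0 : 0 ≤ 2 / q := by positivity
  have hs : ∀ X : E →ₗ[ℝ] F, 0 ≤ ∑ j, (‖X (v j)‖ ^ 2) ^ (q / 2) := fun X =>
    Finset.sum_nonneg fun j _ => Real.rpow_nonneg (sq_nonneg _) _
  exact hM.trans (add_le_add (Real.rpow_le_rpow (hs X) (hcol X) h0)
    (Real.rpow_le_rpow (hs Y) (hcol Y) h0))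

end LinearMap

end SingularValues

/-! ### Perturbation bounds for the truncation -/

section TruncationPerturbation

open scoped RealInnerProductSpace
open Module

variable {E F : Type*} [NormedAddCommGroup E] [InnerProductSpace ℝ E] [FiniteDimensional ℝ E]
  [NormedAddCommGroup F] [InnerProductSpace ℝ F] [FiniteDimensional ℝ F]

/-- `T'` is the sum of the first `r` terms of the singular decomposition of `T` given by `u`
and `v`. -/
structure IsTruncation {N : ℕ} (r : ℕ) (T T' : E →ₗ[ℝ] F) (u : Fin N → F) (v : Fin N → E) :
    Prop where
  decomp : SingularDecomp T (fun j : Fin N => T.singularValues j) u v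
  apply_eq : ∀ x, T' x = ∑ j : Fin N with j.val < r, (T.singularValues j * ⟪v j, x⟫) • u j

namespace IsTruncation

variable {N r : ℕ} {T T' : E →ₗ[ℝ] F} {u : Fin N → F} {v : Fin N → E}

theorem residual (h : IsTruncation r T T' u v) :
    SingularDecomp (T - T') (fun j : {j : Fin N // r ≤ j.val} => T.singularValues j.1)
      (fun j => u j.1) (fun j => v j.1) := by
  refine ⟨h.decomp.left.comp _ Subtype.val_injective, h.decomp.right.comp _ Subtype.val_injective,
    fun x => ?_⟩
  rw [LinearMap.sub_apply, h.apply_eq, h.decomp.apply_eq,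
    ← Finset.sum_filter_add_sum_filter_not Finset.univ (fun j : Fin N => j.val < r),
    add_sub_cancel_left]
  simp_rw [not_lt]
  exact Finset.sum_subtype _ (by simp) _

theorem apply_right_of_lt (h : IsTruncation r T T' u v) {j : Fin N} (hj : j.val < r) :
    T' (v j) = T.singularValues j • u j := by
  rw [h.apply_eq, Finset.sum_eq_single j]
  · simp [h.decomp.right.1 j]
  · intro b _ hb
    simp [h.decomp.right.2 hb]
  · simp [hj]

/-- Testing `T'` on the leading singular pairs of `T` gives the only direction needed, without
computing the singular values of `T'`. -/
theorem sum_range_singularValues_rpow_le (h : IsTruncation r T T' u v) (hrN : r ≤ N) {q : ℝ}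
    (hq : 1 ≤ q) : ∑ n ∈ Finset.range r, T.singularValues n ^ q ≤ T'.schattenSum q := by
  have h1 := T'.sum_rpow_abs_inner_le (l := r)
    (h.decomp.left.comp _ (Fin.castLE_injective hrN)).isBessel
    (h.decomp.right.comp _ (Fin.castLE_injective hrN)).isBessel hq
  refine le_trans (le_of_eq ?_) (h1.trans (T'.sum_range_singularValues_rpow_le (by linarith) r))
  rw [← Fin.sum_univ_eq_sum_range (fun n => T.singularValues n ^ q)]
  refine Finset.sum_congr rfl fun j _ => ?_
  rw [Function.comp_apply, Function.comp_apply, h.apply_right_of_lt (by simp),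
    real_inner_smul_right, real_inner_self_eq_norm_sq, h.decomp.left.1]
  simp [abs_of_nonneg (T.singularValues_nonneg _)]

theorem singularValues_zero_le (h : IsTruncation r T T' u v) (hr : 0 < r) (hrN : r ≤ N) :
    T.singularValues 0 ≤ T'.singularValues 0 := by
  have hN : 0 < N := hr.trans_le hrN
  have h1 := T'.abs_inner_le_singularValues_zero (h.decomp.left.1 ⟨0, hN⟩)
    (h.decomp.right.1 ⟨0, hN⟩)
  rw [h.apply_right_of_lt (j := ⟨0, hN⟩) hr, real_inner_smul_right, real_inner_self_eq_norm_sq,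
    h.decomp.left.1] at h1
  simpa [abs_of_nonneg (T.singularValues_nonneg _)] using h1

theorem exists_starProjection (h : IsTruncation r T T' u v) (hrN : r ≤ N) :
    ∃ K : Submodule ℝ F, finrank ℝ K ≤ r ∧ ∀ x, K.starProjection (T x) = T' x := by
  set K : Submodule ℝ F := Submodule.span ℝ (Set.range fun j : Fin r => u (j.castLE hrN)) with hK
  refine ⟨K, (finrank_range_le_card _).trans_eq (Fintype.card_fin r), fun x => ?_⟩
  have hlt : ∀ j : Fin N, j.val < r → K.starProjection (u j) = u j := fun j hj =>
    K.starProjection_eq_self_iff.2 (Submodule.subset_span ⟨⟨j, hj⟩, rfl⟩)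
  have hge : ∀ j : Fin N, ¬ j.val < r → K.starProjection (u j) = 0 := by
    intro j hj
    rw [Submodule.starProjection_apply_eq_zero_iff, Submodule.mem_orthogonal]
    intro w hw
    induction hw using Submodule.span_induction with
    | mem w hw =>
      obtain ⟨i, rfl⟩ := hw
      refine h.decomp.left.2 fun hij => hj ?_
      rw [← hij]
      exact i.2
    | zero => simp
    | add a b _ _ ha hb => rw [inner_add_left, ha, hb, add_zero]
    | smul c a _ ha => rw [real_inner_smul_left, ha, mul_zero]
  rw [h.apply_eq, h.decomp.apply_eq, map_sum, Finset.sum_filter]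
  refine Finset.sum_congr rfl fun j _ => ?_
  split_ifs with hj
  · rw [map_smul, hlt j hj]
  · rw [map_smul, hge j hj, smul_zero]

variable {a z a' : E →ₗ[ℝ] F}

/-- By Weyl, coefficient `j ≥ r` of the residual is at most `σ_{j-r}(z)`, and `j ↦ j - r` is
injective there. -/
theorem sum_rpow_abs_inner_residual_le (h : IsTruncation r (a + z) a' u v)
    (ha : finrank ℝ a.range ≤ r) {l : ℕ} {x : Fin l → F} {y : Fin l → E} (hx : IsBessel x)
    (hy : IsBessel y) {q : ℝ} (hq : 1 ≤ q) :
    ∑ i, |⟪x i, (a + z - a') (y i)⟫| ^ q ≤ ∑ n ∈ Finset.range l, z.singularValues n ^ q := by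
  refine h.residual.sum_rpow_abs_inner_le (fun j => LinearMap.singularValues_nonneg _ _)
    (fun j => j.1.val - r) ?_ z.singularValues z.singularValues_antitone
    z.singularValues_nonneg ?_ hx hy hq
  · intro i j hij
    have hi := i.2
    have hj := j.2
    have : i.1.val - r = j.1.val - r := hij
    exact Subtype.ext (Fin.ext (by omega))
  · intro j
    have := LinearMap.singularValues_add_le a z ha (j.1.val - r)
    rwa [Nat.add_sub_cancel' j.2] at this

/-- The identity `a' - a = z - (a + z - a')` is tested on the top singular pair of `a' - a`, which
exists unless that map is zero. -/
theorem singularValues_zero_sub_le (h : IsTruncation r (a + z) a' u v)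
    (ha : finrank ℝ a.range ≤ r) :
    (a' - a).singularValues 0 ≤ 2 * z.singularValues 0 := by
  obtain hk | hk := Nat.eq_zero_or_pos (finrank ℝ (a' - a).range)
  · rw [(a' - a).singularValues_eq_zero_iff_le_finrank_range.2 hk.le]
    exact mul_nonneg zero_le_two (z.singularValues_nonneg 0)
  obtain ⟨x, y, hd⟩ := (a' - a).exists_singularDecomp
  have hx := hd.left.1 ⟨0, hk⟩
  have hy := hd.right.1 ⟨0, hk⟩
  have h0 := hd.inner_left_apply_right ⟨0, hk⟩
  have h1 := z.abs_inner_le_singularValues_zero hx hy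
  have h2 := h.sum_rpow_abs_inner_residual_le ha (l := 1) (x := fun _ => x ⟨0, hk⟩)
    (y := fun _ => y ⟨0, hk⟩)
    (Orthonormal.isBessel ⟨fun _ => hx, fun i j hij => (hij (Subsingleton.elim i j)).elim⟩)
    (Orthonormal.isBessel ⟨fun _ => hy, fun i j hij => (hij (Subsingleton.elim i j)).elim⟩)
    (q := 1) le_rfl
  have e : a' - a = z - (a + z - a') := by abel
  simp only [Finset.univ_unique, Real.rpow_one, Finset.sum_const, Finset.card_singleton, one_smul,
    Finset.range_one, Finset.sum_singleton] at h2
  have h3 : ⟪x ⟨0, hk⟩, (a' - a) (y ⟨0, hk⟩)⟫ =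
      ⟪x ⟨0, hk⟩, z (y ⟨0, hk⟩)⟫ - ⟪x ⟨0, hk⟩, (a + z - a') (y ⟨0, hk⟩)⟫ := by
    rw [← inner_sub_right, ← LinearMap.sub_apply, ← e]
  rw [h0] at h3
  change (a' - a).singularValues 0 = _ at h3
  linarith [(abs_le.1 h1).2, (abs_le.1 h2).1]

/-- The compressed error equals `P z`; moving `P` onto the left singular vectors leaves a diagonal
of `z` with at most `r` entries. -/
theorem _root_.LinearMap.schattenSum_starProjection_comp_sub_le {K : Submodule ℝ F}
    (hK : finrank ℝ K ≤ r) (hKa : ∀ x, K.starProjection ((a + z) x) = a' x) {q : ℝ} (hq : 1 ≤ q) :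
    LinearMap.schattenSum (K.starProjection.toLinearMap ∘ₗ (a' - a)) q ≤
      ∑ n ∈ Finset.range r, z.singularValues n ^ q := by
  set X := K.starProjection.toLinearMap ∘ₗ (a' - a) with hX
  have hXz : ∀ w, X w = K.starProjection (z w) := by
    intro w
    have h1 : K.starProjection (a' w) = a' w := by
      rw [← hKa, K.starProjection_eq_self_iff]
      exact K.starProjection_apply_mem _
    have h2 : X w = K.starProjection (a' w) - K.starProjection (a w) := by
      simp [hX]
    rw [h2, h1, ← hKa, LinearMap.add_apply, map_add, add_sub_cancel_left]
  have hrank : finrank ℝ X.range ≤ r := by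
    refine (Submodule.finrank_mono ?_).trans hK
    rintro _ ⟨w, rfl⟩
    exact K.starProjection_apply_mem _
  obtain ⟨x, y, hd⟩ := X.exists_singularDecomp
  refine le_trans (le_of_eq ?_) ((z.sum_rpow_abs_inner_le (hd.left.isBessel.starProjection K)
    hd.right.isBessel hq).trans (z.sum_range_singularValues_rpow_mono q hrank))
  refine Finset.sum_congr rfl fun i _ => ?_
  rw [Submodule.inner_starProjection_left_eq_right, ← hXz, hd.inner_left_apply_right,
    abs_of_nonneg (X.singularValues_nonneg _)]

/-- Perturbation bound for the projection of `a` onto the complement of the leading left singular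
vectors of `a + z`. -/
theorem schattenSum_starProjection_orthogonal_le (h : IsTruncation r (a + z) a' u v)
    (ha : finrank ℝ a.range ≤ r) {K : Submodule ℝ F}
    (hKa : ∀ x, K.starProjection ((a + z) x) = a' x) {q : ℝ} (hq : 1 ≤ q) :
    LinearMap.schattenSum (Kᗮ.starProjection.toLinearMap ∘ₗ (a' - a)) q ≤
      2 ^ q * ∑ n ∈ Finset.range r, z.singularValues n ^ q := by
  set X := Kᗮ.starProjection.toLinearMap ∘ₗ (a' - a) with hX
  have hq0 : 0 < q := by linarith
  have hz0 : ∀ w, Kᗮ.starProjection (a' w) = 0 := by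
    intro w
    rw [← hKa]
    exact Submodule.starProjection_orthogonal_apply_eq_zero (K.starProjection_apply_mem _)
  -- This form shows that the rank is at most `r`; `hXz` below controls the size.
  have hXa : X = Kᗮ.starProjection.toLinearMap ∘ₗ (-a) := by
    ext w
    simp only [hX, LinearMap.comp_apply, ContinuousLinearMap.coe_coe, LinearMap.sub_apply,
      LinearMap.neg_apply, map_sub, map_neg, hz0, zero_sub]
  have hXz : ∀ w, X w = Kᗮ.starProjection (z w) - (a + z - a') w := by
    intro w
    have h1 : (a + z - a') w = Kᗮ.starProjection ((a + z) w) := by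
      rw [LinearMap.sub_apply, ← hKa, Submodule.starProjection_orthogonal_val]
    have h2 : X w = - Kᗮ.starProjection (a w) := by
      rw [hXa, LinearMap.comp_apply, LinearMap.neg_apply, map_neg]
      rfl
    rw [h1, h2, LinearMap.add_apply, map_add]
    abel
  have hrank : finrank ℝ X.range ≤ r := by
    rw [hXa, LinearMap.range_comp, LinearMap.range_neg]
    exact (Submodule.finrank_map_le _ _).trans ha
  obtain ⟨x, y, hd⟩ := X.exists_singularDecomp
  set S := ∑ n ∈ Finset.range r, z.singularValues n ^ q with hS
  have hS0 : 0 ≤ S := Finset.sum_nonneg fun n _ => Real.rpow_nonneg (z.singularValues_nonneg n) q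
  have h1 : ∑ i, |⟪Kᗮ.starProjection (x i), z (y i)⟫| ^ q ≤ S :=
    (z.sum_rpow_abs_inner_le (hd.left.isBessel.starProjection Kᗮ)
      hd.right.isBessel hq).trans (z.sum_range_singularValues_rpow_mono q hrank)
  have h2 : ∑ i, |-⟪x i, (a + z - a') (y i)⟫| ^ q ≤ S := by
    simp_rw [abs_neg]
    exact (h.sum_rpow_abs_inner_residual_le ha hd.left.isBessel hd.right.isBessel hq).trans
      (z.sum_range_singularValues_rpow_mono q hrank)
  -- The two diagonals sum to the singular values of `X`, and each has `ℓ^q` norm at most `S ^ (1 /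
  -- q)`: hence the factor `2`.
  have hM := Real.Lp_add_le Finset.univ (fun i => ⟪Kᗮ.starProjection (x i), z (y i)⟫)
    (fun i => -⟪x i, (a + z - a') (y i)⟫) hq
  have e : ∑ i, |⟪Kᗮ.starProjection (x i), z (y i)⟫ + -⟪x i, (a + z - a') (y i)⟫| ^ q =
      X.schattenSum q := by
    refine Finset.sum_congr rfl fun i _ => ?_
    rw [Submodule.inner_starProjection_left_eq_right, ← sub_eq_add_neg, ← inner_sub_right, ← hXz,
      hd.inner_left_apply_right, abs_of_nonneg (X.singularValues_nonneg _)]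
  rw [e] at hM
  have hinv : 0 ≤ 1 / q := by positivity
  have h3 := Real.rpow_le_rpow (Finset.sum_nonneg fun i _ =>
    Real.rpow_nonneg (abs_nonneg _) _) h1 hinv
  have h4 := Real.rpow_le_rpow (Finset.sum_nonneg fun i _ =>
    Real.rpow_nonneg (abs_nonneg _) _) h2 hinv
  have h5 : X.schattenSum q ^ (1 / q) ≤ 2 * S ^ (1 / q) := by linarith
  have h6 := Real.rpow_le_rpow (Real.rpow_nonneg (X.schattenSum_nonneg q) _) h5 hq0.le
  rwa [Real.mul_rpow zero_le_two (Real.rpow_nonneg hS0 _), one_div,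
    Real.rpow_inv_rpow (X.schattenSum_nonneg q) hq0.ne', Real.rpow_inv_rpow hS0 hq0.ne'] at h6

theorem schattenSum_sub_le_of_le_two (h : IsTruncation r (a + z) a' u v) (hrN : r ≤ N)
    (ha : finrank ℝ a.range ≤ r) {q : ℝ} (hq : 1 ≤ q) (hq2 : q ≤ 2) :
    (a' - a).schattenSum q ≤
      (2 ^ q + 1) * ∑ n ∈ Finset.range r, z.singularValues n ^ q := by
  obtain ⟨K, hK, hKa⟩ := h.exists_starProjection hrN
  have h1 := (a' - a).schattenSum_le_add_of_le_two K (by linarith) hq2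
  have h2 := LinearMap.schattenSum_starProjection_comp_sub_le hK hKa hq
  have h3 := h.schattenSum_starProjection_orthogonal_le ha hKa hq
  linarith

theorem schattenSum_sub_rpow_le_of_two_le (h : IsTruncation r (a + z) a' u v) (hrN : r ≤ N)
    (ha : finrank ℝ a.range ≤ r) {q : ℝ} (hq : 2 ≤ q) :
    (a' - a).schattenSum q ^ (1 / q) ≤
      √5 * (∑ n ∈ Finset.range r, z.singularValues n ^ q) ^ (1 / q) := by
  obtain ⟨K, hK, hKa⟩ := h.exists_starProjection hrN
  have hq1 : 1 ≤ q := by linarith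
  have hq0 : 0 < q := by linarith
  have h1 := (a' - a).schattenSum_rpow_le_add_of_two_le K hq
  have h2 := LinearMap.schattenSum_starProjection_comp_sub_le hK hKa hq1
  have h3 := h.schattenSum_starProjection_orthogonal_le ha hKa hq1
  set S := ∑ n ∈ Finset.range r, z.singularValues n ^ q with hS
  have hS0 : 0 ≤ S := Finset.sum_nonneg fun n _ => Real.rpow_nonneg (z.singularValues_nonneg n) q
  have hinv : 0 ≤ 2 / q := by positivity
  have h4 := Real.rpow_le_rpow (LinearMap.schattenSum_nonneg _ _) h2 hinv
  have h5 := Real.rpow_le_rpow (LinearMap.schattenSum_nonneg _ _) h3 hinv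
  have e2 : ((2 : ℝ) ^ q) ^ (2 / q) = 4 := by
    rw [← Real.rpow_mul zero_le_two, mul_div_cancel₀ _ hq0.ne']
    norm_num
  rw [Real.mul_rpow (by positivity) hS0, e2] at h5
  have esq : ∀ t : ℝ, 0 ≤ t → t ^ (2 / q) = (t ^ (1 / q)) ^ 2 := fun t ht => by
    rw [← Real.rpow_natCast, ← Real.rpow_mul ht]
    congr 1
    push_cast
    ring
  rw [esq _ (LinearMap.schattenSum_nonneg _ _)] at h1
  rw [esq _ hS0] at h4 h5
  -- After squaring, the part in `K` contributes `1` and the part in `Kᗮ` contributes `4`.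
  refine abs_le_of_sq_le_sq' ?_ (by positivity) |>.2
  rw [mul_pow, Real.sq_sqrt (by norm_num)]
  linarith

end IsTruncation

end TruncationPerturbation

/-! ### Transfer from linear maps to matrices -/

section MatrixBound

open scoped RealInnerProductSpace
open Module

variable {m n : ℕ}

theorem Matrix.toEuclideanLin_vecMulVec_apply (x : EuclideanSpace ℝ (Fin m))
    (y w : EuclideanSpace ℝ (Fin n)) :
    Matrix.toEuclideanLin (Matrix.vecMulVec x y) w = ⟪y, w⟫ • x := by
  ext i
  simp [Matrix.toLpLin_apply, Matrix.vecMulVec_mulVec,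
    EuclideanSpace.inner_eq_star_dotProduct, dotProduct_comm]

theorem Matrix.toEuclideanLin_sum_smul_vecMulVec_apply {ι : Type*} (t : Finset ι) (s : ι → ℝ)
    (u : ι → EuclideanSpace ℝ (Fin m)) (v : ι → EuclideanSpace ℝ (Fin n))
    (x : EuclideanSpace ℝ (Fin n)) :
    Matrix.toEuclideanLin (∑ i ∈ t, s i • Matrix.vecMulVec (u i) (v i)) x =
      ∑ i ∈ t, (s i * ⟪v i, x⟫) • u i := by
  rw [map_sum, LinearMap.sum_apply]
  refine Finset.sum_congr rfl fun i _ => ?_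
  rw [map_smul, LinearMap.smul_apply, Matrix.toEuclideanLin_vecMulVec_apply, smul_smul]

theorem IsTruncatedSVD.exists_isTruncation {r : ℕ} {M M' : Matrix (Fin m) (Fin n) ℝ}
    (h : IsTruncatedSVD r M M') :
    ∃ (u : Fin (min m n) → EuclideanSpace ℝ (Fin m))
      (v : Fin (min m n) → EuclideanSpace ℝ (Fin n)),
      IsTruncation r (Matrix.toEuclideanLin M) (Matrix.toEuclideanLin M') u v := by
  obtain ⟨u, v, ⟨hu, hv, hM⟩, hM'⟩ := h
  refine ⟨u, v, ⟨hu, hv, fun x => ?_⟩, fun x => ?_⟩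
  · conv_lhs => rw [hM]
    exact Matrix.toEuclideanLin_sum_smul_vecMulVec_apply _ _ _ _ _
  · rw [hM']
    exact Matrix.toEuclideanLin_sum_smul_vecMulVec_apply _ _ _ _ _

theorem Matrix.finrank_range_toEuclideanLin (M : Matrix (Fin m) (Fin n) ℝ) :
    finrank ℝ (Matrix.toEuclideanLin M).range = M.rank :=
  (M.rank_eq_finrank_range_toLin (PiLp.basisFun 2 ℝ (Fin m)) (PiLp.basisFun 2 ℝ (Fin n))).symm

theorem Matrix.rank_le_min (M : Matrix (Fin m) (Fin n) ℝ) : M.rank ≤ min m n :=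
  le_min M.rank_le_height M.rank_le_width

theorem schattenNorm_of_ne_top {q : ℝ≥0∞} (hq : q ≠ ∞) (hq0 : q.toReal ≠ 0)
    (M : Matrix (Fin m) (Fin n) ℝ) :
    schattenNorm q M = (Matrix.toEuclideanLin M).schattenSum q.toReal ^ (1 / q.toReal) := by
  rw [schattenNorm, if_neg hq, ← LinearMap.sum_range_singularValues_rpow_eq _ hq0
    (l := min m n) (by rw [M.finrank_range_toEuclideanLin]; exact M.rank_le_min),
    ← Fin.sum_univ_eq_sum_range
      (fun i => (Matrix.toEuclideanLin M).singularValues i ^ q.toReal)]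
  rfl

end MatrixBound

theorem theorem1 {m n r : ℕ} (A Z B Ahat Zr : Matrix (Fin m) (Fin n) ℝ)
    (hB : B = A + Z) (hA : A.rank = r)
    (hAhat : IsTruncatedSVD r B Ahat) (hZr : IsTruncatedSVD r Z Zr) (q : ℝ≥0∞) :
    (1 ≤ q → q ≤ 2 →
      schattenNorm q (Ahat - A)
        ≤ ((2 : ℝ) ^ q.toReal + 1) ^ (1 / q.toReal) * schattenNorm q Zr) ∧
    (2 ≤ q → q < ∞ →
      schattenNorm q (Ahat - A) ≤ (√5 : ℝ) * schattenNorm q Zr) ∧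
    (q = ∞ →
      schattenNorm q (Ahat - A) ≤ 2 * schattenNorm q Zr) := by
  subst hB
  obtain ⟨u, v, h⟩ := hAhat.exists_isTruncation
  obtain ⟨u', v', h'⟩ := hZr.exists_isTruncation
  rw [map_add] at h
  have hrN : r ≤ min m n := hA ▸ A.rank_le_min
  have ha : Module.finrank ℝ (Matrix.toEuclideanLin A).range ≤ r := by
    rw [A.finrank_range_toEuclideanLin, hA]
  refine ⟨fun hq1 hq2 => ?_, fun hq2 hqt => ?_, fun hq => ?_⟩
  · have hqt : q ≠ ∞ := (hq2.trans_lt (by simp)).ne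
    have h1 : 1 ≤ q.toReal := by simpa using ENNReal.toReal_mono hqt hq1
    have h2 : q.toReal ≤ 2 := by simpa using ENNReal.toReal_mono (by simp) hq2
    have h0 : q.toReal ≠ 0 := by linarith
    rw [schattenNorm_of_ne_top hqt h0, schattenNorm_of_ne_top hqt h0, map_sub,
      ← Real.mul_rpow (by positivity) (LinearMap.schattenSum_nonneg _ _)]
    refine Real.rpow_le_rpow (LinearMap.schattenSum_nonneg _ _) ?_ (by positivity)
    refine (h.schattenSum_sub_le_of_le_two hrN ha h1 h2).trans ?_
    gcongr
    exact h'.sum_range_singularValues_rpow_le hrN h1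
  · have h2 : 2 ≤ q.toReal := by simpa using ENNReal.toReal_mono hqt.ne hq2
    have h0 : q.toReal ≠ 0 := by linarith
    rw [schattenNorm_of_ne_top hqt.ne h0, schattenNorm_of_ne_top hqt.ne h0, map_sub]
    refine (h.schattenSum_sub_rpow_le_of_two_le hrN ha h2).trans ?_
    gcongr
    · exact Finset.sum_nonneg fun i _ => Real.rpow_nonneg (LinearMap.singularValues_nonneg _ i) _
    · exact h'.sum_range_singularValues_rpow_le hrN (by linarith)
  · simp only [schattenNorm, if_pos hq, singularValue, map_sub]
    -- For `r = 0` there is no leading pair on which to test `Zr`, but then `A` and `Ahat` both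
    -- vanish.
    obtain rfl | hr := Nat.eq_zero_or_pos r
    · have hA0 : Matrix.toEuclideanLin A = 0 := by
        rw [← LinearMap.range_eq_bot, ← Submodule.finrank_eq_zero]
        omega
      have hAhat0 : Matrix.toEuclideanLin Ahat = 0 := by
        ext1 x
        simp [h.apply_eq]
      rw [hA0, hAhat0, sub_zero, LinearMap.singularValues_zero]
      exact mul_nonneg zero_le_two (LinearMap.singularValues_nonneg _ _)
    · exact (h.singularValues_zero_sub_le ha).trans
        (mul_le_mul_of_nonneg_left (h'.singularValues_zero_le hr hrN) zero_le_two)
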